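/- Consider the binary symmetric channel (BSC) with crossover probability $p\in[0,1]$, with causal noiseless feedback. A variable-length resolvability code with $k$ coin-flips is a family of deterministic maps $\mathrm{enc}^{(k)}_n:\{0,1\}^k\times\{0,1\}^{n-1}\to\{0,1\}\cup\{\mathsf S\}$, $n\ge 1$: holding a word $W^k$ uniformly distributed on $\{0,1\}^k$ and having observed the past channel outputs $V^{n-1}$, the encoder feeds $\mathrm{enc}^{(k)}_n(W^k,V^{n-1})$ to the channel, or stops if this value is $\mathsf S$. Let $N_k$ be the (random) number of channel uses, let $P_V$ be the uniform distribution on $\{0,1\}$, and let $$\mathbb D_k=\sum_{n}D\bigl(P_{V^n\mid N_k=n}\,\big\|\,P_V^n\bigr)\Pr\{N_k=n\}$$ be the expected output divergence, where $D$ is the Kullback–Leibler divergence; all logarithms are to base $2$. Put $c_2(p)=1-h_2(p)$, where $h_2$ is the binary entropy function. Theorem. For every $p\in[0,1]$ and every $R\ge 0$, the straight-line exponent $E=[R-c_2(p)]^+=\max\{R-c_2(p),0\}$ is achievable over the BSC with crossover probability $p$ with respect to the uniform reference measure: there is a sequence (indexed by $k$) of variable-length resolvability codes with $k$ coin-flips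 such that $\mathbb E[N_k]<\infty$ for every $k$, $$\lim_{k\to\infty}\frac{k}{\mathbb E[N_k]}=R\qquad\text{and}\qquad \liminf_{k\to\infty}\,-\frac{\log \mathbb D_k}{\mathbb E[N_k]}\ \ge\ E=[R-c_2(p)]^+$$ (with $-\log 0=+\infty$). In particular $\limsup_{k\to\infty}k/\mathbb E[N_k]\le R$, so $(R,E)$ is an achievable resolvability rate–exponent pair. -/

import Mathlib

open MeasureTheory Filter Topology
open scoped ENNReal

noncomputable section

namespace Resolvability

/-- A variable-length resolvability code with `k` coin-flips, causal noiseless feedback, input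
alphabet `U` and output alphabet `V`.  `enc n w v` is the action of the encoder that holds the
word `w` and has so far observed the `n` channel outputs `v`: either `some u` (transmit the symbol
`u` in the next channel use) or `none` (the end-of-transmission symbol). -/
structure FeedbackCode (U V : Type*) (k : ℕ) where
  enc : (n : ℕ) → (Fin k → Bool) → (Fin n → V) → Option U

section Law

variable {U V : Type*}

/-- Probability that the encoder's action is to use the channel and that the channel then
outputs `v`. -/
def stepProb (W : U → PMF V) : Option U → V → ℝ≥0∞
  | some u, v => W u v
  | none, _ => 0

/-- Given the word `w`, the probability that the encoder uses the channel at least `n` times and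
that the first `n` outputs are `v`. -/
def pathProb (W : U → PMF V) {k : ℕ} (C : FeedbackCode U V k) (w : Fin k → Bool)
    {n : ℕ} (v : Fin n → V) : ℝ≥0∞ :=
  ∏ i : Fin n, stepProb W (C.enc i w (fun j : Fin i => v (Fin.castLE i.isLt.le j))) (v i)

/-- `Pr{V^n = v, N_k = n}`, where the word is uniform on `{0,1}^k` and `N_k` is the number of
channel uses. -/
def stopProb (W : U → PMF V) {k : ℕ} (C : FeedbackCode U V k) {n : ℕ} (v : Fin n → V) : ℝ≥0∞ :=
  ((2 : ℝ≥0∞) ^ k)⁻¹ *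
    ∑ w : Fin k → Bool, if (C.enc n w v).isNone then pathProb W C w v else 0

variable [Fintype V]

/-- `Pr{N_k = n}`. -/
def lengthProb (W : U → PMF V) {k : ℕ} (C : FeedbackCode U V k) (n : ℕ) : ℝ≥0∞ :=
  ∑ v : Fin n → V, stopProb W C v

/-- `E[N_k]`, the expectation of a variable with values in `{0, 1, 2, …} ∪ {∞}`. -/
def expectedLength (W : U → PMF V) {k : ℕ} (C : FeedbackCode U V k) : ℝ≥0∞ :=
  ∑' n : ℕ, (n : ℝ≥0∞) * lengthProb W C n + ⊤ * (1 - ∑' n : ℕ, lengthProb W C n)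

variable [MeasurableSpace V]

/-- The conditional law of the output string `V^n` given `N_k = n` (the zero measure if
`Pr{N_k = n} = 0`). -/
def outputLaw (W : U → PMF V) {k : ℕ} (C : FeedbackCode U V k) (n : ℕ) : Measure (Fin n → V) :=
  (lengthProb W C n)⁻¹ • ∑ v : Fin n → V, stopProb W C v • Measure.dirac v

/-- Kullback-Leibler divergence in bits. -/
def klDivBits {α : Type*} [MeasurableSpace α] (μ ν : Measure α) : ℝ≥0∞ :=
  InformationTheory.klDiv μ ν / ENNReal.ofReal (Real.log 2)

/-- The expected output divergence (in bits) with respect to the reference measure `PV`: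
`∑ n, D(P_{V^n | N_k = n} ‖ P_V^n) * Pr{N_k = n}`. -/
def expectedDivergence (W : U → PMF V) (PV : PMF V) {k : ℕ} (C : FeedbackCode U V k) : ℝ≥0∞ :=
  ∑' n : ℕ, klDivBits (outputLaw W C n) (Measure.pi fun _ : Fin n => PV.toMeasure) *
    lengthProb W C n

/-- Base-two logarithm on `[0, ∞]`, with `log₂ 0 = -∞` and `log₂ ∞ = ∞`. -/
def elog2 (x : ℝ≥0∞) : EReal := ENNReal.log x / (Real.log 2 : EReal)

/-- The sequence `C` of codes achieves the resolvability rate-exponent pair `(R, E)` over the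
memoryless channel `W` with respect to the reference measure `PV`. -/
structure AchievesRateExponent (W : U → PMF V) (PV : PMF V) (C : (k : ℕ) → FeedbackCode U V k)
    (R E : ℝ) : Prop where
  length_ne_top : ∀ k, expectedLength W (C k) ≠ ⊤
  rate : limsup (fun k : ℕ => (((k : ℝ≥0∞) / expectedLength W (C k) : ℝ≥0∞) : EReal)) atTop
    ≤ (R : EReal)
  exponent : (E : EReal) ≤ liminf (fun k : ℕ =>
    -elog2 (expectedDivergence W PV (C k)) / (expectedLength W (C k) : EReal)) atTop

end Law

/-- The binary symmetric channel with crossover probability `p`. -/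
def bsc (p : ℝ) (hp : p ∈ Set.Icc (0 : ℝ) 1) (u : Bool) : PMF Bool :=
  PMF.ofFintype (fun v => if v = u then ENNReal.ofReal (1 - p) else ENNReal.ofReal p) (by
    have h : ENNReal.ofReal (1 - p) + ENNReal.ofReal p = 1 := by
      rw [← ENNReal.ofReal_add (by linarith [hp.2]) hp.1]; simp
    cases u
    · simpa [add_comm] using h
    · simpa using h)

/-- Binary capacity function `c₂(p) = 1 - h₂(p)`, with the binary entropy in bits. -/
def binCapacity (p : ℝ) : ℝ := 1 - Real.binEntropy p / Real.log 2

end Resolvability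

end

noncomputable section

namespace Resolvability

open InformationTheory

/-! ### Divergence from the uniform law -/

/-! Feedback reveals the noise `z = x ⊕ v`, so the encoder can stop as a function of `z` alone; the
stopping time `N` is then independent of the message and the codebook. It sends a codeword until the
information density of `z` exceeds `γ`, and until time `m` at the latest. Every noise string `z` of
length `n` on which it stops satisfies `2 ^ n * P(z) ≤ 2 * exp γ`, with only one symbol of overshoot
(`two_pow_mul_noiseStop_le`).

Take `2 ^ k` independent uniform codewords. For fixed `v`, `2 ^ n * Pr{V^n = v, N = n}` is an
average of `2 ^ k` i.i.d. terms in `[0, M]`, `M = 2 * exp γ`, with mean `a = Pr{N = n}`, so its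
variance is at most `2 ^ (-k) * M * a`. The divergence is bounded by chi-squared, where division by
`a` cancels this factor: each `n ≤ m` costs at most `2 ^ (-k) * M`, up to `log 2`, and some codebook
does as well as the average (`exists_codebook`).

With `γ = m * c₂(p) * log 2 + o(m)`, a Chernoff bound shows that early stopping is rare enough for
`E[N] ≥ m - K` (`exists_le_expectedLength`). Choosing `k / m → R` yields the exponent `R - c₂(p)`.
If `R ≤ c₂(p)`, only exponent `0` is required, and a fixed-length code suffices because its
divergence is at most linear in `m`. -/

lemma klFun_le_sq {x : ℝ} (hx : 0 ≤ x) : klFun x ≤ (x - 1) ^ 2 := by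
  unfold klFun
  rcases hx.eq_or_lt with rfl | hx
  · simp
  -- `x log x ≤ x (x - 1)`, and adding `1 - x` gives the square.
  · nlinarith [mul_le_mul_of_nonneg_left (Real.log_le_sub_one_of_pos hx) hx.le]

lemma klFun_le_mul_log {x b : ℝ} (hx : 0 ≤ x) (hxb : x ≤ b) :
    klFun x ≤ x * Real.log b + 1 := by
  unfold klFun
  rcases hx.eq_or_lt with rfl | hx
  · simp
  · nlinarith [mul_le_mul_of_nonneg_left (Real.log_le_log hx hxb) hx.le]

lemma pi_uniform_singleton (n : ℕ) (v : Fin n → Bool) :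
    (Measure.pi fun _ : Fin n => (PMF.uniformOfFintype Bool).toMeasure) {v} =
      ENNReal.ofReal ((2 : ℝ) ^ n)⁻¹ := by
  rw [Measure.pi_singleton]
  have h : ∀ b : Bool, (PMF.uniformOfFintype Bool).toMeasure {b} = 2⁻¹ := by
    intro b
    rw [PMF.toMeasure_apply_singleton _ _ (measurableSet_singleton _)]
    simp
  simp only [h, Finset.prod_const, Finset.card_univ, Fintype.card_fin]
  rw [ENNReal.ofReal_inv_of_pos (by positivity), ENNReal.ofReal_pow (by norm_num),
    ENNReal.ofReal_ofNat, ENNReal.inv_pow]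

/-- The Kullback-Leibler divergence of a weighted sum of point masses from a measure charging every
point of a finite space. -/
lemma klDiv_sum_smul_dirac {α : Type*} [Fintype α] [MeasurableSpace α]
    [MeasurableSingletonClass α] (ν : Measure α) [IsFiniteMeasure ν] (f : α → ℝ≥0∞)
    {c : α → ℝ} (hc : ∀ x, 0 < c x) (hν : ∀ x, ν {x} = ENNReal.ofReal (c x))
    {r : α → ℝ} (hr : ∀ x, 0 ≤ r x) (hf : ∀ x, f x = ENNReal.ofReal (r x)) :
    klDiv (∑ x, f x • Measure.dirac x) ν
      = ∑ x, ENNReal.ofReal (klFun (r x / c x)) * ENNReal.ofReal (c x) := by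
  have hμ : (∑ x, f x • Measure.dirac x)
      = ν.withDensity (fun x => ENNReal.ofReal (r x / c x)) := by
    classical
    refine Measure.ext_of_singleton fun y => ?_
    rw [withDensity_apply _ (measurableSet_singleton _), lintegral_singleton, hν,
      ← ENNReal.ofReal_mul (div_nonneg (hr y) (hc y).le), div_mul_cancel₀ _ (hc y).ne',
      Measure.finsetSum_apply, Finset.sum_eq_single y]
    · simp [hf]
    · intro b _ hb
      simp [hb]
    · simp
  have hmeas : Measurable (fun x => ENNReal.ofReal (r x / c x)) := measurable_of_finite _
  have : ∀ᵐ x ∂ν, ENNReal.ofReal (klFun ((ν.withDensity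
      (fun x => ENNReal.ofReal (r x / c x))).rnDeriv ν x).toReal)
      = ENNReal.ofReal (klFun (r x / c x)) := by
    filter_upwards [Measure.rnDeriv_withDensity ν hmeas] with x hx
    rw [hx, ENNReal.toReal_ofReal (div_nonneg (hr x) (hc x).le)]
  have : IsFiniteMeasure (ν.withDensity (fun x => ENNReal.ofReal (r x / c x))) := by
    rw [← hμ]
    refine ⟨?_⟩
    rw [Measure.finsetSum_apply]
    simp [hf]
  rw [hμ, klDiv_eq_lintegral_klFun_of_ac (withDensity_absolutelyContinuous _ _),
    lintegral_congr_ae ‹_›, lintegral_fintype]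
  simp [hν]

section Code

variable {k n : ℕ} (W : Bool → PMF Bool) (C : FeedbackCode Bool Bool k)

/-- The contribution of the event `N = n` to the expected divergence, in terms of the joint
probabilities `r v = Pr{V^n = v, N = n}`. -/
lemma klDivBits_mul_lengthProb_le {r : (Fin n → Bool) → ℝ} (hr : ∀ v, 0 ≤ r v)
    (hC : ∀ v, stopProb W C v = ENNReal.ofReal (r v)) {φ : (Fin n → Bool) → ℝ}
    (hφ : 0 < ∑ v, r v → ∀ v, klFun (r v * 2 ^ n / ∑ v, r v) ≤ φ v) :
    klDivBits (outputLaw W C n)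
        (Measure.pi fun _ : Fin n => (PMF.uniformOfFintype Bool).toMeasure) * lengthProb W C n
      ≤ ENNReal.ofReal ((∑ v, r v) * ((2 ^ n)⁻¹ * ∑ v, φ v) / Real.log 2) := by
  set a := ∑ v, r v with ha
  have hlen : lengthProb W C n = ENNReal.ofReal a := by
    simp only [lengthProb, hC]
    rw [ENNReal.ofReal_sum_of_nonneg fun v _ => hr v]
  have ha0 : 0 ≤ a := Finset.sum_nonneg fun v _ => hr v
  rcases ha0.eq_or_lt with h0 | hpos
  -- A length of probability zero has weight `0`, which kills even an infinite divergence.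
  · rw [hlen, ← h0]; simp
  have hlog : 0 < Real.log 2 := Real.log_pos one_lt_two
  have hlaw : outputLaw W C n = ∑ v, ENNReal.ofReal (r v / a) • Measure.dirac v := by
    rw [outputLaw, hlen, Finset.smul_sum]
    refine Finset.sum_congr rfl fun v _ => ?_
    rw [smul_smul, hC, ← ENNReal.ofReal_inv_of_pos hpos,
      ← ENNReal.ofReal_mul (inv_nonneg.2 ha0), inv_mul_eq_div]
  have hkl0 : ∀ v, 0 ≤ klFun (r v * 2 ^ n / a) := fun v =>
    klFun_nonneg (div_nonneg (mul_nonneg (hr v) (by positivity)) ha0)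
  rw [klDivBits, hlaw, klDiv_sum_smul_dirac _ _ (c := fun _ => ((2 : ℝ) ^ n)⁻¹)
    (fun _ => by positivity) (pi_uniform_singleton n) (r := fun v => r v / a)
    (fun v => div_nonneg (hr v) ha0) (fun _ => rfl), hlen]
  have : ∀ v, r v / a / ((2 : ℝ) ^ n)⁻¹ = r v * 2 ^ n / a := by
    intro v; rw [div_inv_eq_mul]; ring
  simp only [this]
  rw [← Finset.sum_mul, ← ENNReal.ofReal_sum_of_nonneg fun v _ => hkl0 v,
    ← ENNReal.ofReal_mul (Finset.sum_nonneg fun v _ => hkl0 v),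
    ← ENNReal.ofReal_div_of_pos hlog, ← ENNReal.ofReal_mul (div_nonneg
      (mul_nonneg (Finset.sum_nonneg fun v _ => hkl0 v) (by positivity)) hlog.le)]
  apply ENNReal.ofReal_le_ofReal
  have hsum : ∑ v, klFun (r v * 2 ^ n / a) ≤ ∑ v, φ v :=
    Finset.sum_le_sum fun v _ => hφ hpos v
  calc _ = a * ((2 ^ n)⁻¹ * ∑ v, klFun (r v * 2 ^ n / a)) / Real.log 2 := by ring
    _ ≤ _ := by gcongr

/-- A bound by the chi-squared distance from the uniform law. -/
lemma klDivBits_mul_lengthProb_le_sq {r : (Fin n → Bool) → ℝ} (hr : ∀ v, 0 ≤ r v)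
    (hC : ∀ v, stopProb W C v = ENNReal.ofReal (r v)) :
    klDivBits (outputLaw W C n)
        (Measure.pi fun _ : Fin n => (PMF.uniformOfFintype Bool).toMeasure) * lengthProb W C n
      ≤ ENNReal.ofReal ((∑ v, r v)⁻¹ * ((2 ^ n)⁻¹ * ∑ v, (2 ^ n * r v - ∑ v, r v) ^ 2)
          / Real.log 2) := by
  refine (klDivBits_mul_lengthProb_le W C hr hC
    (φ := fun v => ((2 ^ n * r v - ∑ v, r v) / ∑ v, r v) ^ 2) fun hpos v => ?_).trans_eq ?_
  · refine (klFun_le_sq (div_nonneg (mul_nonneg (hr v) (by positivity)) hpos.le)).trans_eq ?_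
    congr 1
    field_simp
  · congr 2
    simp only [div_pow, ← Finset.sum_div]
    rcases eq_or_ne (∑ v, r v) 0 with h | h
    · simp [h]
    · field_simp

/-- The divergence of a law on binary strings of length `n` from the uniform law is about `n` bits
at most. -/
lemma klDivBits_mul_lengthProb_le_length {r : (Fin n → Bool) → ℝ} (hr : ∀ v, 0 ≤ r v)
    (hC : ∀ v, stopProb W C v = ENNReal.ofReal (r v)) :
    klDivBits (outputLaw W C n)
        (Measure.pi fun _ : Fin n => (PMF.uniformOfFintype Bool).toMeasure) * lengthProb W C n
      ≤ ENNReal.ofReal ((∑ v, r v) * (n * Real.log 2 + 1) / Real.log 2) := by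
  rcases (Finset.sum_nonneg fun v _ => hr v : 0 ≤ ∑ v, r v).eq_or_lt with h0 | hpos
  · refine (klDivBits_mul_lengthProb_le W C hr hC (φ := fun _ => 0) fun h => ?_).trans_eq ?_
    · exact absurd h0 h.ne
    · simp [← h0]
  -- The likelihood ratio is at most `2 ^ n` and has mean `1` under the uniform law, hence the
  -- average `n log 2 + 1`.
  refine (klDivBits_mul_lengthProb_le W C hr hC
    (φ := fun v => (r v * 2 ^ n / ∑ v, r v) * (n * Real.log 2) + 1) fun hpos v => ?_).trans_eq ?_
  · rw [← Real.log_pow]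
    refine klFun_le_mul_log (div_nonneg (mul_nonneg (hr v) (by positivity)) hpos.le) ?_
    rw [div_le_iff₀ hpos, mul_comm]
    gcongr
    exact Finset.single_le_sum (fun v _ => hr v) (Finset.mem_univ v)
  · congr 3
    rw [Finset.sum_add_distrib, ← Finset.sum_mul, ← Finset.sum_div, ← Finset.sum_mul]
    simp only [Finset.sum_const, Finset.card_univ, Fintype.card_pi, Fintype.card_bool,
      Finset.prod_const, Fintype.card_fin, nsmul_eq_mul]
    push_cast
    field_simp

end Code

/-! ### Codes that stop according to the channel noise -/

/-- The first `i` entries of a string. -/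
def pre {n : ℕ} (z : Fin n → Bool) (i : Fin n) : Fin i → Bool :=
  fun j => z (Fin.castLE i.isLt.le j)

/-- The rule `T` asks to stop after the noise string `z`, and not before. -/
def FirstStop (T : (n : ℕ) → (Fin n → Bool) → Prop) {n : ℕ} (z : Fin n → Bool) : Prop :=
  T n z ∧ ∀ i : Fin n, ¬ T i (pre z i)

/-- The law of a noise bit of the binary symmetric channel. -/
def flipProb (p : ℝ) : Bool → ℝ
  | false => 1 - p
  | true => p

/-- The probability of a noise string. -/
def noiseProb (p : ℝ) {n : ℕ} (z : Fin n → Bool) : ℝ := ∏ i, flipProb p (z i)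

open Classical in
/-- The probability that the noise starts with `z` and that this is where the rule `T` stops. -/
def noiseStop (p : ℝ) (T : (n : ℕ) → (Fin n → Bool) → Prop) {n : ℕ} (z : Fin n → Bool) : ℝ :=
  if FirstStop T z then noiseProb p z else 0

/-- The probability that the rule `T` stops at time `n`. -/
def stopTimeProb (p : ℝ) (T : (n : ℕ) → (Fin n → Bool) → Prop) (n : ℕ) : ℝ :=
  ∑ z : Fin n → Bool, noiseStop p T z

open Classical in
/-- The probability that the rule `T` does not stop before time `n`. -/
def aliveProb (p : ℝ) (T : (n : ℕ) → (Fin n → Bool) → Prop) (n : ℕ) : ℝ :=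
  ∑ z : Fin n → Bool, if ∀ i : Fin n, ¬ T i (pre z i) then noiseProb p z else 0

open Classical in
/-- The code that sends the codeword `X w` until the noise triggers the rule `T`. -/
def stoppingCode {k : ℕ} (X : (Fin k → Bool) → ℕ → Bool)
    (T : (n : ℕ) → (Fin n → Bool) → Prop) : FeedbackCode Bool Bool k where
  enc n w v := if T n (fun i => xor (X w i) (v i)) then none else some (X w n)

variable {p : ℝ} {T : (n : ℕ) → (Fin n → Bool) → Prop}

lemma flipProb_nonneg (hp : p ∈ Set.Icc (0 : ℝ) 1) (b : Bool) : 0 ≤ flipProb p b := by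
  cases b
  · exact sub_nonneg.2 hp.2
  · exact hp.1

lemma flipProb_le_one (hp : p ∈ Set.Icc (0 : ℝ) 1) (b : Bool) : flipProb p b ≤ 1 := by
  cases b
  · exact sub_le_self _ hp.1
  · exact hp.2

lemma sum_flipProb (p : ℝ) : ∑ b, flipProb p b = 1 := by simp [flipProb]

lemma noiseProb_nonneg (hp : p ∈ Set.Icc (0 : ℝ) 1) {n : ℕ} (z : Fin n → Bool) :
    0 ≤ noiseProb p z := Finset.prod_nonneg fun i _ => flipProb_nonneg hp (z i)

lemma noiseStop_nonneg (hp : p ∈ Set.Icc (0 : ℝ) 1) {n : ℕ} (z : Fin n → Bool) :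
    0 ≤ noiseStop p T z := by
  unfold noiseStop
  split_ifs
  exacts [noiseProb_nonneg hp z, le_rfl]

lemma stopTimeProb_nonneg (hp : p ∈ Set.Icc (0 : ℝ) 1) (n : ℕ) : 0 ≤ stopTimeProb p T n :=
  Finset.sum_nonneg fun z _ => noiseStop_nonneg hp z

lemma bsc_apply (hp : p ∈ Set.Icc (0 : ℝ) 1) (u v : Bool) :
    bsc p hp u v = ENNReal.ofReal (flipProb p (xor u v)) := by
  cases u <;> cases v <;> simp [bsc, flipProb]

open Classical in
lemma pathProb_stoppingCode (hp : p ∈ Set.Icc (0 : ℝ) 1) {k : ℕ} (X : (Fin k → Bool) → ℕ → Bool)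
    (w : Fin k → Bool) {n : ℕ} (v : Fin n → Bool) :
    pathProb (bsc p hp) (stoppingCode X T) w v
      = ENNReal.ofReal (if ∀ i : Fin n, ¬ T i (pre (fun j : Fin n => xor (X w j) (v j)) i)
          then noiseProb p (fun j : Fin n => xor (X w j) (v j)) else 0) := by
  unfold pathProb
  split_ifs with h
  · rw [noiseProb, ENNReal.ofReal_prod_of_nonneg fun i _ => flipProb_nonneg hp _]
    refine Finset.prod_congr rfl fun i _ => ?_
    rw [← bsc_apply hp]
    have : (stoppingCode X T).enc i w (fun j : Fin i => v (Fin.castLE i.isLt.le j))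
        = some (X w i) := if_neg (h i)
    rw [this]
    rfl
  · push Not at h
    obtain ⟨i, hi⟩ := h
    rw [ENNReal.ofReal_zero]
    refine Finset.prod_eq_zero (Finset.mem_univ i) ?_
    have : (stoppingCode X T).enc i w (fun j : Fin i => v (Fin.castLE i.isLt.le j))
        = none := if_pos hi
    rw [this]
    rfl

lemma stopProb_stoppingCode (hp : p ∈ Set.Icc (0 : ℝ) 1) {k : ℕ}
    (X : (Fin k → Bool) → ℕ → Bool) {n : ℕ} (v : Fin n → Bool) :
    stopProb (bsc p hp) (stoppingCode X T) v
      = ENNReal.ofReal ((2 ^ k)⁻¹ *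
          ∑ w, noiseStop p T (fun j : Fin n => xor (X w j) (v j))) := by
  classical
  rw [stopProb, ENNReal.ofReal_mul (by positivity), ENNReal.ofReal_inv_of_pos (by positivity),
    ENNReal.ofReal_pow (by norm_num), ENNReal.ofReal_ofNat,
    ENNReal.ofReal_sum_of_nonneg fun w _ => noiseStop_nonneg hp _]
  congr 1
  refine Finset.sum_congr rfl fun w _ => ?_
  have henc : ((stoppingCode X T).enc n w v).isNone
      = decide (T n (fun j : Fin n => xor (X w j) (v j))) := by
    simp only [stoppingCode]
    split_ifs with h <;> simp [h]
  rw [pathProb_stoppingCode, henc, noiseStop, FirstStop]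
  by_cases h : T n (fun j : Fin n => xor (X w j) (v j)) <;> simp [h]

/-- Adding a fixed string is a permutation of the binary strings. -/
lemma sum_xor {n : ℕ} (x : Fin n → Bool) (f : (Fin n → Bool) → ℝ) :
    ∑ v : Fin n → Bool, f (fun j => xor (x j) (v j)) = ∑ z, f z := by
  have hinv : Function.Involutive (fun (v : Fin n → Bool) j => xor (x j) (v j)) := by
    intro v
    funext j
    simp
  exact Equiv.sum_comp hinv.toPerm f

/-- For each word, summing over outputs is summing over noise strings, so the codebook drops out. -/
lemma sum_stopProb (p : ℝ) {k : ℕ} (X : (Fin k → Bool) → ℕ → Bool) (n : ℕ) :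
    ∑ v : Fin n → Bool, (2 ^ k : ℝ)⁻¹ * ∑ w, noiseStop p T (fun j : Fin n => xor (X w j) (v j))
      = stopTimeProb p T n := by
  rw [← Finset.mul_sum, Finset.sum_comm]
  have : ∀ w, ∑ v : Fin n → Bool, noiseStop p T (fun j : Fin n => xor (X w j) (v j))
      = stopTimeProb p T n := fun w => sum_xor (fun j : Fin n => X w j) (noiseStop p T)
  simp [this]

lemma lengthProb_stoppingCode (hp : p ∈ Set.Icc (0 : ℝ) 1) {k : ℕ}
    (X : (Fin k → Bool) → ℕ → Bool) (n : ℕ) :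
    lengthProb (bsc p hp) (stoppingCode X T) n = ENNReal.ofReal (stopTimeProb p T n) := by
  rw [← sum_stopProb p X n, ENNReal.ofReal_sum_of_nonneg]
  · exact Finset.sum_congr rfl fun v _ => stopProb_stoppingCode hp X v
  · exact fun v _ => mul_nonneg (by positivity)
      (Finset.sum_nonneg fun w _ => noiseStop_nonneg hp _)

/-! ### The stopping time -/

lemma sum_noiseProb_mul_prod (p : ℝ) (n : ℕ) (g : Bool → ℝ) :
    ∑ z : Fin n → Bool, noiseProb p z * ∏ i, g (z i) = (∑ b, flipProb p b * g b) ^ n := by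
  simp only [noiseProb, ← Finset.prod_mul_distrib]
  rw [← Fintype.piFinset_univ, ← Finset.prod_univ_sum (fun _ : Fin n => Finset.univ)
    (fun _ b => flipProb p b * g b)]
  simp

lemma aliveProb_zero : aliveProb p T 0 = 1 := by
  simp [aliveProb, noiseProb]

/-- Survival to time `n + 1` depends only on the first `n` noise bits; the last bit sums out to `1`.
-/
lemma aliveProb_succ (p : ℝ) (T : (n : ℕ) → (Fin n → Bool) → Prop) (n : ℕ) :
    aliveProb p T (n + 1) = aliveProb p T n - stopTimeProb p T n := by
  classical
  have hpre : ∀ (z : Fin n → Bool) (b : Bool),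
      (∀ i : Fin (n + 1), ¬ T i (pre (Fin.snoc z b : Fin (n + 1) → Bool) i))
        ↔ (∀ i : Fin n, ¬ T i (pre z i)) ∧ ¬ T n z := by
    intro z b
    rw [Fin.forall_fin_succ']
    have h1 : ∀ i : Fin n, pre (Fin.snoc z b : Fin (n + 1) → Bool) i.castSucc = pre z i := by
      intro i
      funext j
      exact Fin.snoc_castSucc (α := fun _ => Bool) b z (Fin.castLE i.isLt.le j)
    have h2 : pre (Fin.snoc z b : Fin (n + 1) → Bool) (Fin.last n) = z := by
      funext j
      exact Fin.snoc_castSucc (α := fun _ => Bool) b z j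
    constructor
    · rintro ⟨h, h'⟩
      exact ⟨fun i => h1 i ▸ h i, h2 ▸ h'⟩
    · rintro ⟨h, h'⟩
      exact ⟨fun i => (h1 i).symm ▸ h i, h2.symm ▸ h'⟩
  have hw : ∀ (z : Fin n → Bool) (b : Bool),
      noiseProb p (Fin.snoc z b : Fin (n + 1) → Bool) = noiseProb p z * flipProb p b := by
    intro z b
    simp [noiseProb, Fin.prod_univ_castSucc]
  unfold aliveProb stopTimeProb
  rw [← (Fin.snocEquiv fun _ => Bool).sum_comp, Fintype.sum_prod_type_right,
    ← Finset.sum_sub_distrib]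
  refine Finset.sum_congr rfl fun z _ => ?_
  simp only [Fin.snocEquiv, Equiv.coe_fn_mk, hpre, hw, noiseStop, FirstStop]
  by_cases h : ∀ i : Fin n, ¬ T i (pre z i) <;> by_cases h' : T n z <;>
    simp [h, h', ← Finset.mul_sum, flipProb]

lemma sum_stopTimeProb_add (p : ℝ) (T : (n : ℕ) → (Fin n → Bool) → Prop) (n : ℕ) :
    ∑ i ∈ Finset.range n, stopTimeProb p T i + aliveProb p T n = 1 := by
  induction n with
  | zero => simp [aliveProb_zero]
  | succ n ih => rw [Finset.sum_range_succ, aliveProb_succ, ← ih]; ring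

section Horizon

variable {m : ℕ} (hT : ∀ z : Fin m → Bool, T m z)
include hT

lemma aliveProb_eq_zero {n : ℕ} (hn : m < n) : aliveProb p T n = 0 := by
  refine Finset.sum_eq_zero fun z _ => if_neg ?_
  push Not
  exact ⟨⟨m, hn⟩, hT _⟩

lemma stopTimeProb_eq_zero {n : ℕ} (hn : m < n) : stopTimeProb p T n = 0 := by
  have := aliveProb_succ p T n
  rw [aliveProb_eq_zero hT hn, aliveProb_eq_zero hT (hn.trans n.lt_succ_self)] at this
  linarith

lemma sum_stopTimeProb : ∑ i ∈ Finset.range (m + 1), stopTimeProb p T i = 1 := by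
  rw [← sum_stopTimeProb_add p T (m + 1), aliveProb_eq_zero hT m.lt_succ_self, add_zero]

/-- The stopping probabilities up to `m` sum to `1`, so the `⊤` term of `expectedLength` vanishes.
-/
lemma expectedLength_stoppingCode (hp : p ∈ Set.Icc (0 : ℝ) 1) {k : ℕ}
    (X : (Fin k → Bool) → ℕ → Bool) :
    expectedLength (bsc p hp) (stoppingCode X T)
      = ENNReal.ofReal (∑ i ∈ Finset.range (m + 1), i * stopTimeProb p T i) := by
  have h0 : ∀ n ∉ Finset.range (m + 1), stopTimeProb p T n = 0 := fun n hn =>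
    stopTimeProb_eq_zero hT (by simpa using hn)
  unfold expectedLength
  simp only [lengthProb_stoppingCode]
  rw [tsum_eq_sum (s := Finset.range (m + 1)) fun n hn => by simp [h0 n hn],
    tsum_eq_sum (s := Finset.range (m + 1)) fun n hn => by simp [h0 n hn],
    ← ENNReal.ofReal_sum_of_nonneg fun i _ => stopTimeProb_nonneg hp i, sum_stopTimeProb hT,
    ENNReal.ofReal_sum_of_nonneg fun i _ =>
      mul_nonneg (Nat.cast_nonneg i) (stopTimeProb_nonneg hp i)]
  simp [ENNReal.ofReal_mul]

lemma expectedLength_stoppingCode_le (hp : p ∈ Set.Icc (0 : ℝ) 1) :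
    ∑ i ∈ Finset.range (m + 1), i * stopTimeProb p T i ≤ m := by
  calc ∑ i ∈ Finset.range (m + 1), i * stopTimeProb p T i
      ≤ ∑ i ∈ Finset.range (m + 1), m * stopTimeProb p T i := by
        refine Finset.sum_le_sum fun i hi => ?_
        have := stopTimeProb_nonneg (T := T) hp i
        have : i ≤ m := Nat.lt_succ_iff.1 (Finset.mem_range.1 hi)
        gcongr
    _ = m := by rw [← Finset.mul_sum, sum_stopTimeProb hT, mul_one]

lemma le_expectedLength_stoppingCode (hp : p ∈ Set.Icc (0 : ℝ) 1) :
    m * (1 - ∑ i ∈ Finset.range m, stopTimeProb p T i)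
      ≤ ∑ i ∈ Finset.range (m + 1), i * stopTimeProb p T i := by
  have h := sum_stopTimeProb (p := p) hT
  rw [Finset.sum_range_succ] at h ⊢
  have : 1 - ∑ i ∈ Finset.range m, stopTimeProb p T i = stopTimeProb p T m := by linarith
  rw [this]
  exact le_add_of_nonneg_left (Finset.sum_nonneg fun i _ =>
    mul_nonneg (Nat.cast_nonneg i) (stopTimeProb_nonneg hp i))

lemma expectedDivergence_stoppingCode (hp : p ∈ Set.Icc (0 : ℝ) 1) {k : ℕ}
    (X : (Fin k → Bool) → ℕ → Bool) :
    expectedDivergence (bsc p hp) (PMF.uniformOfFintype Bool) (stoppingCode X T)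
      = ∑ n ∈ Finset.range (m + 1), klDivBits (outputLaw (bsc p hp) (stoppingCode X T) n)
          (Measure.pi fun _ : Fin n => (PMF.uniformOfFintype Bool).toMeasure) *
            lengthProb (bsc p hp) (stoppingCode X T) n := by
  refine tsum_eq_sum fun n hn => ?_
  rw [lengthProb_stoppingCode, stopTimeProb_eq_zero hT (by simpa using hn)]
  simp

end Horizon

/-! ### Stopping when the information density exceeds a threshold -/

/-- The information density `∑ log (2 P(z_j))` (in nats) carried by a noise string. -/
def infoDensity (p : ℝ) {n : ℕ} (z : Fin n → Bool) : ℝ := ∑ j, Real.log (2 * flipProb p (z j))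

/-- Stop as soon as the information density exceeds `γ`, and at time `m` at the latest. -/
def thresholdRule (p γ : ℝ) (m n : ℕ) (z : Fin n → Bool) : Prop := n = m ∨ γ < infoDensity p z

variable {p : ℝ}

lemma two_pow_mul_noiseProb_le (hp : p ∈ Set.Icc (0 : ℝ) 1) {n : ℕ} (z : Fin n → Bool) :
    2 ^ n * noiseProb p z ≤ Real.exp (infoDensity p z) := by
  have : (2 : ℝ) ^ n * noiseProb p z = ∏ i, (2 * flipProb p (z i)) := by
    simp [noiseProb, Finset.prod_mul_distrib]
  rw [this, infoDensity, Real.exp_sum]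
  -- Only an inequality: for an impossible noise bit `Real.log 0 = 0`, and the factor `0` is bounded
  -- by `exp 0 = 1`.
  refine Finset.prod_le_prod (fun i _ => mul_nonneg zero_le_two (flipProb_nonneg hp _))
    fun i _ => Real.le_exp_log _

/-- One bit before stopping the density was still at most `γ`, and the last bit contributes a factor
of at most `2`. Stopping at time `0` is covered by `γ ≥ 0`. -/
lemma two_pow_mul_noiseStop_le (hp : p ∈ Set.Icc (0 : ℝ) 1) {γ : ℝ} (hγ : 0 ≤ γ) {m n : ℕ}
    (z : Fin n → Bool) :
    2 ^ n * noiseStop p (thresholdRule p γ m) z ≤ 2 * Real.exp γ := by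
  have hpos := Real.one_le_exp hγ
  unfold noiseStop
  split_ifs with h
  swap
  · rw [mul_zero]; positivity
  cases n with
  | zero => simp only [noiseProb, Finset.univ_eq_empty, Finset.prod_empty, pow_zero]; linarith
  | succ n =>
    have hlast := h.2 (Fin.last n)
    unfold thresholdRule at hlast
    push Not at hlast
    have h1 : noiseProb p z ≤ noiseProb p (pre z (Fin.last n)) := by
      simp only [noiseProb]
      rw [Fin.prod_univ_castSucc]
      exact mul_le_of_le_one_right
        (noiseProb_nonneg hp (fun i : Fin n => z i.castSucc)) (flipProb_le_one hp _)
    calc 2 ^ (n + 1) * noiseProb p z ≤ 2 ^ (n + 1) * noiseProb p (pre z (Fin.last n)) := by gcongr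
      _ = 2 * (2 ^ n * noiseProb p (pre z (Fin.last n))) := by ring
      _ ≤ 2 * Real.exp (infoDensity p (pre z (Fin.last n))) :=
        mul_le_mul_of_nonneg_left (two_pow_mul_noiseProb_le hp _) zero_le_two
      _ ≤ 2 * Real.exp γ := by gcongr; exact hlast.2

/-- The mean information density per channel use is the capacity, in nats. -/
lemma sum_flipProb_mul_log (p : ℝ) :
    ∑ b, flipProb p b * Real.log (2 * flipProb p b) = binCapacity p * Real.log 2 := by
  have h : ∀ x : ℝ, x * Real.log (2 * x) = x * Real.log 2 - x * Real.log x⁻¹ := by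
    intro x
    rcases eq_or_ne x 0 with rfl | hx
    · simp
    · rw [Real.log_mul two_ne_zero hx, Real.log_inv]; ring
  have hl : Real.log 2 ≠ 0 := (Real.log_pos one_lt_two).ne'
  simp only [Fintype.sum_bool, h, flipProb, binCapacity, Real.binEntropy]
  field_simp
  ring

lemma binCapacity_nonneg (p : ℝ) : 0 ≤ binCapacity p := by
  rw [binCapacity, sub_nonneg, div_le_one (Real.log_pos one_lt_two)]
  exact Real.binEntropy_le_log_two

/-- A bound on the moment generating function of the information density of one bit. -/
lemma sum_flipProb_mul_exp_le (hp : p ∈ Set.Icc (0 : ℝ) 1) {B s : ℝ} (hs : 0 ≤ s)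
    (hB : ∀ b, |Real.log (2 * flipProb p b)| ≤ B) (hsB : s * B ≤ 1) :
    ∑ b, flipProb p b * Real.exp (s * Real.log (2 * flipProb p b))
      ≤ Real.exp (s * (binCapacity p * Real.log 2) + s ^ 2 * B ^ 2) := by
  have hb : ∀ b, Real.exp (s * Real.log (2 * flipProb p b))
      ≤ 1 + s * Real.log (2 * flipProb p b) + s ^ 2 * B ^ 2 := by
    intro b
    have h1 : |s * Real.log (2 * flipProb p b)| ≤ s * B := by
      rw [abs_mul, abs_of_nonneg hs]
      exact mul_le_mul_of_nonneg_left (hB b) hs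
    -- `exp y ≤ 1 + y + y ^ 2` for `|y| ≤ 1`.
    have h2 := (abs_le.1 (Real.abs_exp_sub_one_sub_id_le (h1.trans hsB))).2
    have h3 : (s * Real.log (2 * flipProb p b)) ^ 2 ≤ (s * B) ^ 2 :=
      sq_le_sq' (abs_le.1 h1).1 (abs_le.1 h1).2
    rw [mul_pow s B] at h3
    linarith
  calc ∑ b, flipProb p b * Real.exp (s * Real.log (2 * flipProb p b))
      ≤ ∑ b, flipProb p b * (1 + s * Real.log (2 * flipProb p b) + s ^ 2 * B ^ 2) :=
        Finset.sum_le_sum fun b _ => mul_le_mul_of_nonneg_left (hb b) (flipProb_nonneg hp b)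
    _ = ∑ b, flipProb p b * (1 + s ^ 2 * B ^ 2)
          + s * ∑ b, flipProb p b * Real.log (2 * flipProb p b) := by
        rw [Finset.mul_sum, ← Finset.sum_add_distrib]
        exact Finset.sum_congr rfl fun b _ => by ring
    _ = s * (binCapacity p * Real.log 2) + s ^ 2 * B ^ 2 + 1 := by
        rw [← Finset.sum_mul, sum_flipProb, sum_flipProb_mul_log]; ring
    _ ≤ _ := Real.add_one_le_exp _

/-- The threshold is crossed early with small probability. -/
lemma stopTimeProb_thresholdRule_le (hp : p ∈ Set.Icc (0 : ℝ) 1) {B s γ : ℝ} (hs : 0 ≤ s)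
    (hB : ∀ b, |Real.log (2 * flipProb p b)| ≤ B) (hsB : s * B ≤ 1) {m n : ℕ} (hn : n < m) :
    stopTimeProb p (thresholdRule p γ m) n
      ≤ Real.exp (m * (s * (binCapacity p * Real.log 2) + s ^ 2 * B ^ 2) - s * γ) := by
  -- Chernoff: before `m`, stopping means density above `γ`, so the indicator is at most `exp (s *
  -- (density - γ))`.
  have hz : ∀ z : Fin n → Bool, noiseStop p (thresholdRule p γ m) z
      ≤ Real.exp (-(s * γ)) *
        (noiseProb p z * ∏ i, Real.exp (s * Real.log (2 * flipProb p (z i)))) := by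
    intro z
    have h0 := noiseProb_nonneg hp z
    rw [← Real.exp_sum, ← Finset.mul_sum, mul_left_comm, ← Real.exp_add]
    unfold noiseStop
    split_ifs with h
    · have hγ : γ < infoDensity p z := h.1.resolve_left hn.ne
      refine le_mul_of_one_le_right h0 (Real.one_le_exp ?_)
      have := mul_le_mul_of_nonneg_left hγ.le hs
      rw [infoDensity] at this
      linarith
    · positivity
  -- Nonnegativity of the exponent per bit allows `n` to be replaced by `m`.
  have hc : 0 ≤ s * (binCapacity p * Real.log 2) + s ^ 2 * B ^ 2 := by
    have := binCapacity_nonneg p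
    have := Real.log_nonneg one_le_two
    positivity
  calc stopTimeProb p (thresholdRule p γ m) n
      ≤ Real.exp (-(s * γ)) *
          (∑ b, flipProb p b * Real.exp (s * Real.log (2 * flipProb p b))) ^ n := by
        rw [← sum_noiseProb_mul_prod, Finset.mul_sum]
        exact Finset.sum_le_sum fun z _ => hz z
    _ ≤ Real.exp (-(s * γ)) *
          Real.exp (s * (binCapacity p * Real.log 2) + s ^ 2 * B ^ 2) ^ n := by
        gcongr
        · exact Finset.sum_nonneg fun b _ => mul_nonneg (flipProb_nonneg hp b) (Real.exp_pos _).le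
        · exact sum_flipProb_mul_exp_le hp hs hB hsB
    _ ≤ _ := by
        rw [← Real.exp_nat_mul, ← Real.exp_add, Real.exp_le_exp]
        have : (n : ℝ) ≤ m := by exact_mod_cast hn.le
        nlinarith [mul_le_mul_of_nonneg_right this hc]

/-! ### Random codebooks -/

section Codebook

variable {A B : Type*} [Fintype A] [DecidableEq A] [Fintype B]

/-- Each codeword of a uniform codebook is uniform, stated as a count to avoid division. -/
lemma card_mul_sum_apply (f : B → ℝ) (a : A) :
    (Fintype.card B : ℝ) * ∑ X : A → B, f (X a) = Fintype.card (A → B) * ∑ b, f b := by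
  classical
  rw [Fintype.card_congr (Equiv.funSplitAt a B), ← (Equiv.funSplitAt a B).symm.sum_comp,
    Fintype.sum_prod_type, Fintype.card_prod]
  simp only [Equiv.funSplitAt, Equiv.piSplitAt_symm_apply, dite_true, Finset.sum_const,
    Finset.card_univ, nsmul_eq_mul, ← Finset.mul_sum]
  push_cast
  ring

lemma sum_apply_mul_apply_eq_zero {h : B → ℝ} (hh : ∑ b, h b = 0) {a a' : A} (ha : a' ≠ a) :
    ∑ X : A → B, h (X a) * h (X a') = 0 := by
  classical
  rw [← (Equiv.funSplitAt a B).symm.sum_comp, Fintype.sum_prod_type_right]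
  simp [Equiv.funSplitAt, Equiv.piSplitAt_symm_apply, ha, ← Finset.sum_mul, hh]

/-- The variance of a sum of independent identically distributed variables. -/
lemma card_mul_sum_sq {h : B → ℝ} (hh : ∑ b, h b = 0) :
    (Fintype.card B : ℝ) * ∑ X : A → B, (∑ a, h (X a)) ^ 2
      = Fintype.card (A → B) * (Fintype.card A * ∑ b, h b ^ 2) := by
  have h1 : ∀ X : A → B, (∑ a, h (X a)) ^ 2 = ∑ a, ∑ a', h (X a) * h (X a') := fun X => by
    rw [sq, Finset.sum_mul_sum]
  have h2 : ∀ a : A, ∑ X : A → B, ∑ a', h (X a) * h (X a') = ∑ X : A → B, h (X a) ^ 2 := by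
    intro a
    rw [Finset.sum_comm, Finset.sum_eq_single a]
    · simp [sq]
    · exact fun a' _ ha' => sum_apply_mul_apply_eq_zero hh ha'
    · simp
  simp only [h1]
  rw [Finset.sum_comm, Finset.mul_sum]
  simp only [h2, card_mul_sum_apply (fun b => h b ^ 2), Finset.sum_const, Finset.card_univ,
    nsmul_eq_mul]
  ring

end Codebook

/-- A prefix of a uniformly distributed string is uniformly distributed. -/
lemma sum_castLE {n m : ℕ} (hn : n ≤ m) (g : (Fin n → Bool) → ℝ) :
    2 ^ n * ∑ b : Fin m → Bool, g (fun j => b (Fin.castLE hn j)) = 2 ^ m * ∑ z, g z := by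
  induction m, hn using Nat.le_induction with
  | base => simp
  | succ m hn ih =>
    rw [← (Fin.snocEquiv fun _ => Bool).sum_comp, Fintype.sum_prod_type_right]
    have : ∀ (z : Fin m → Bool) (c : Bool),
        (fun j => (Fin.snocEquiv fun _ : Fin (m + 1) => Bool) (c, z)
          (Fin.castLE (hn.trans m.le_succ) j)) = fun j => z (Fin.castLE hn j) := by
      intro z c
      funext j
      exact Fin.snoc_castSucc (α := fun _ => Bool) c z (Fin.castLE hn j)
    simp only [this, Finset.sum_const, Finset.card_univ, Fintype.card_bool, nsmul_eq_mul,
      ← Finset.mul_sum]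
    rw [mul_left_comm, ih]
    push_cast
    ring

/-- An extension of finite codewords by zeros. -/
def extendCode {k m : ℕ} (X : (Fin k → Bool) → (Fin m → Bool)) (w : Fin k → Bool) (i : ℕ) : Bool :=
  if h : i < m then X w ⟨i, h⟩ else false

/-- The probabilities `Pr{V^n = v, N = n}` for a given codebook. -/
def jointProb (p : ℝ) (T : (n : ℕ) → (Fin n → Bool) → Prop) {k : ℕ}
    (X : (Fin k → Bool) → ℕ → Bool) {n : ℕ} (v : Fin n → Bool) : ℝ :=
  (2 ^ k)⁻¹ * ∑ w, noiseStop p T (fun j : Fin n => xor (X w j) (v j))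

variable {T : (n : ℕ) → (Fin n → Bool) → Prop}

lemma jointProb_nonneg (hp : p ∈ Set.Icc (0 : ℝ) 1) {k : ℕ} (X : (Fin k → Bool) → ℕ → Bool)
    {n : ℕ} (v : Fin n → Bool) : 0 ≤ jointProb p T X v :=
  mul_nonneg (by positivity) (Finset.sum_nonneg fun _ _ => noiseStop_nonneg hp _)

/-- The variance bound behind soft covering: `u (X w)` below are independent with mean `a` and
values in `[0, M]`, so each has second moment at most `M * a`, and averaging over `2 ^ k` words
divides the variance by `2 ^ k`. -/
lemma sum_jointProb_sq_le (hp : p ∈ Set.Icc (0 : ℝ) 1) {k m n : ℕ} (hn : n ≤ m) {M : ℝ}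
    (hM : ∀ z : Fin n → Bool, 2 ^ n * noiseStop p T z ≤ M) (v : Fin n → Bool) :
    ∑ X : (Fin k → Bool) → (Fin m → Bool),
        (2 ^ n * jointProb p T (extendCode X) v - stopTimeProb p T n) ^ 2
      ≤ Fintype.card ((Fin k → Bool) → (Fin m → Bool)) *
          ((2 ^ k)⁻¹ * (M * stopTimeProb p T n)) := by
  set a := stopTimeProb p T n with ha
  set u : (Fin m → Bool) → ℝ :=
    fun b => 2 ^ n * noiseStop p T (fun j : Fin n => xor (b (Fin.castLE hn j)) (v j)) with hu
  have hu0 : ∀ b, 0 ≤ u b := fun b => mul_nonneg (by positivity) (noiseStop_nonneg hp _)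
  have husum : ∑ b, u b = 2 ^ m * a := by
    rw [hu, ← Finset.mul_sum,
      sum_castLE hn (fun z => noiseStop p T (fun j : Fin n => xor (z j) (v j)))]
    congr 1
    refine Eq.trans (Finset.sum_congr rfl fun z _ => ?_) (sum_xor v (noiseStop p T))
    congr 1
    funext j
    exact Bool.xor_comm _ _
  have hh : ∑ b, (u b - a) = 0 := by
    rw [Finset.sum_sub_distrib, husum]
    simp
  have hsq : ∑ b, (u b - a) ^ 2 ≤ 2 ^ m * (M * a) := by
    calc ∑ b, (u b - a) ^ 2 = ∑ b, (u b ^ 2 - a ^ 2 - 2 * a * (u b - a)) :=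
          Finset.sum_congr rfl fun b _ => by ring
      _ = ∑ b, (u b ^ 2 - a ^ 2) := by
          rw [Finset.sum_sub_distrib, ← Finset.mul_sum, hh, mul_zero, sub_zero]
      _ ≤ ∑ b, M * u b := by
          refine Finset.sum_le_sum fun b _ => ?_
          have := mul_le_mul_of_nonneg_right (hM _ : u b ≤ M) (hu0 b)
          nlinarith [sq_nonneg a]
      _ = 2 ^ m * (M * a) := by rw [← Finset.mul_sum, husum]; ring
  have hX : ∀ X : (Fin k → Bool) → (Fin m → Bool),
      (2 ^ n * jointProb p T (extendCode X) v - a) ^ 2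
        = ((2 ^ k)⁻¹) ^ 2 * (∑ w, (u (X w) - a)) ^ 2 := by
    intro X
    rw [← mul_pow]
    congr 1
    have : ∀ w (j : Fin n), extendCode X w j = X w (Fin.castLE hn j) := by
      intro w j
      exact dif_pos (j.isLt.trans_le hn)
    simp only [jointProb, this, Finset.sum_sub_distrib, hu, ← Finset.mul_sum, Finset.sum_const,
      Finset.card_univ, Fintype.card_pi, Fintype.card_bool, Finset.prod_const, Fintype.card_fin,
      nsmul_eq_mul]
    push_cast
    field_simp
  simp only [hX, ← Finset.mul_sum]
  have hcard := card_mul_sum_sq (A := Fin k → Bool) (h := fun b => u b - a) hh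
  have hB : (Fintype.card (Fin m → Bool) : ℝ) = 2 ^ m := by simp
  have hA : (Fintype.card (Fin k → Bool) : ℝ) = 2 ^ k := by simp
  rw [hB, hA] at hcard
  set c : ℝ := (Fintype.card ((Fin k → Bool) → (Fin m → Bool)) : ℝ)
  have hc : 0 ≤ c := Nat.cast_nonneg _
  have h2m : (0 : ℝ) < 2 ^ m := by positivity
  rw [← mul_le_mul_iff_right₀ h2m, mul_left_comm, hcard]
  calc ((2 ^ k : ℝ)⁻¹) ^ 2 * (c * (2 ^ k * ∑ b, (u b - a) ^ 2))
      ≤ ((2 ^ k : ℝ)⁻¹) ^ 2 * (c * (2 ^ k * (2 ^ m * (M * a)))) := by gcongr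
    _ = 2 ^ m * (c * ((2 ^ k)⁻¹ * (M * a))) := by field_simp

/-- Some codebook makes all chi-squared distances small. -/
lemma exists_codebook (hp : p ∈ Set.Icc (0 : ℝ) 1) (k m : ℕ) {M : ℝ} (hM0 : 0 ≤ M)
    (hM : ∀ (n : ℕ) (z : Fin n → Bool), 2 ^ n * noiseStop p T z ≤ M) :
    ∃ X : (Fin k → Bool) → ℕ → Bool, ∑ n ∈ Finset.range (m + 1), (stopTimeProb p T n)⁻¹ *
        ((2 ^ n)⁻¹ * ∑ v : Fin n → Bool, (2 ^ n * jointProb p T X v - stopTimeProb p T n) ^ 2)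
      ≤ (m + 1) * ((2 ^ k)⁻¹ * M) := by
  set c : ℝ := (Fintype.card ((Fin k → Bool) → (Fin m → Bool)) : ℝ)
  have hc : 0 < c := Nat.cast_pos.2 Fintype.card_pos
  have key : ∑ X : (Fin k → Bool) → (Fin m → Bool),
      ∑ n ∈ Finset.range (m + 1), (stopTimeProb p T n)⁻¹ *
        ((2 ^ n)⁻¹ * ∑ v : Fin n → Bool,
          (2 ^ n * jointProb p T (extendCode X) v - stopTimeProb p T n) ^ 2)
      ≤ ∑ X : (Fin k → Bool) → (Fin m → Bool), (m + 1) * ((2 ^ k)⁻¹ * M) := by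
    rw [Finset.sum_comm]
    have hn : ∀ n ∈ Finset.range (m + 1), ∑ X : (Fin k → Bool) → (Fin m → Bool),
        (stopTimeProb p T n)⁻¹ * ((2 ^ n)⁻¹ * ∑ v : Fin n → Bool,
          (2 ^ n * jointProb p T (extendCode X) v - stopTimeProb p T n) ^ 2)
        ≤ c * ((2 ^ k)⁻¹ * M) := by
      intro n hn
      have ha := stopTimeProb_nonneg (T := T) hp n
      rw [← Finset.mul_sum, ← Finset.mul_sum, Finset.sum_comm]
      calc (stopTimeProb p T n)⁻¹ * ((2 ^ n)⁻¹ * ∑ v : Fin n → Bool,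
            ∑ X : (Fin k → Bool) → (Fin m → Bool),
              (2 ^ n * jointProb p T (extendCode X) v - stopTimeProb p T n) ^ 2)
          ≤ (stopTimeProb p T n)⁻¹ * ((2 ^ n)⁻¹ * ∑ v : Fin n → Bool,
              c * ((2 ^ k)⁻¹ * (M * stopTimeProb p T n))) := by
            gcongr with v
            exact sum_jointProb_sq_le hp (Nat.lt_succ_iff.1 (Finset.mem_range.1 hn)) (hM n) v
        -- This product is `1`, or `0` at lengths of probability zero, so unlikely lengths cost no
        -- more than likely ones.
        _ = ((stopTimeProb p T n)⁻¹ * stopTimeProb p T n) * (c * ((2 ^ k)⁻¹ * M)) := by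
            simp only [Finset.sum_const, Finset.card_univ, Fintype.card_pi, Fintype.card_bool,
              Finset.prod_const, Fintype.card_fin, nsmul_eq_mul]
            push_cast
            field_simp
        _ ≤ c * ((2 ^ k)⁻¹ * M) := by
            refine mul_le_of_le_one_left (by positivity) ?_
            rcases eq_or_ne (stopTimeProb p T n) 0 with h | h
            · simp [h]
            · exact (inv_mul_cancel₀ h).le
    refine (Finset.sum_le_sum hn).trans_eq ?_
    simp only [Finset.sum_const, Finset.card_univ, Finset.card_range, nsmul_eq_mul]
    push_cast
    ring
  obtain ⟨X, _, hX⟩ := Finset.exists_le_of_sum_le Finset.univ_nonempty key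
  exact ⟨extendCode X, hX⟩

/-! ### Codes for a given number of coin-flips -/

section Codes

variable {p : ℝ} {T : (n : ℕ) → (Fin n → Bool) → Prop}

/-- A code whose information density stays below about `γ` at all times has divergence about
`2 ^ (-k) * exp γ` at most. -/
lemma exists_thresholdCode (hp : p ∈ Set.Icc (0 : ℝ) 1) (k m : ℕ) {γ : ℝ} (hγ : 0 ≤ γ) :
    ∃ C : FeedbackCode Bool Bool k,
      expectedLength (bsc p hp) C = ENNReal.ofReal
        (∑ i ∈ Finset.range (m + 1), i * stopTimeProb p (thresholdRule p γ m) i) ∧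
      expectedDivergence (bsc p hp) (PMF.uniformOfFintype Bool) C
        ≤ ENNReal.ofReal ((m + 1) * ((2 ^ k)⁻¹ * (2 * Real.exp γ)) / Real.log 2) := by
  obtain ⟨X, hX⟩ := exists_codebook (T := thresholdRule p γ m) hp k m (by positivity)
    fun n z => two_pow_mul_noiseStop_le hp hγ z
  have hT : ∀ z : Fin m → Bool, thresholdRule p γ m m z := fun z => Or.inl rfl
  refine ⟨stoppingCode X (thresholdRule p γ m), expectedLength_stoppingCode hT hp X, ?_⟩
  rw [expectedDivergence_stoppingCode hT hp]
  have hlog := Real.log_pos one_lt_two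
  have hsum : ∀ n, ∑ v : Fin n → Bool, jointProb p (thresholdRule p γ m) X v
      = stopTimeProb p (thresholdRule p γ m) n := sum_stopProb p X
  refine (Finset.sum_le_sum fun n _ => klDivBits_mul_lengthProb_le_sq _ _
    (fun v => jointProb_nonneg hp X v) (stopProb_stoppingCode hp X)).trans ?_
  simp only [hsum]
  rw [← ENNReal.ofReal_sum_of_nonneg fun n _ => ?_]
  · rw [← Finset.sum_div]
    gcongr
  · have := stopTimeProb_nonneg (T := thresholdRule p γ m) hp n
    positivity

/-- A code of fixed length `m` has divergence about `m` at most. -/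
lemma exists_fixedLengthCode (hp : p ∈ Set.Icc (0 : ℝ) 1) (k m : ℕ) :
    ∃ C : FeedbackCode Bool Bool k, expectedLength (bsc p hp) C = ENNReal.ofReal m ∧
      expectedDivergence (bsc p hp) (PMF.uniformOfFintype Bool) C ≤ ENNReal.ofReal (m + 2) := by
  set T : (n : ℕ) → (Fin n → Bool) → Prop := fun n _ => n = m with hTdef
  have hT : ∀ z : Fin m → Bool, T m z := fun _ => rfl
  have h0 : ∀ n, n ≠ m → stopTimeProb p T n = 0 := fun n hn =>
    Finset.sum_eq_zero fun z _ => if_neg fun h => hn h.1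
  have h1 : stopTimeProb p T m = 1 := by
    rw [← sum_stopTimeProb (p := p) hT,
      Finset.sum_eq_single_of_mem m (Finset.self_mem_range_succ m) fun n _ hn => h0 n hn]
  -- Any codebook would do: the bound uses only the length.
  set X : (Fin k → Bool) → ℕ → Bool := fun _ _ => false
  refine ⟨stoppingCode X T, ?_, ?_⟩
  · rw [expectedLength_stoppingCode hT hp, Finset.sum_eq_single_of_mem m
      (Finset.self_mem_range_succ m) fun n _ hn => by rw [h0 n hn, mul_zero], h1, mul_one]
  · rw [expectedDivergence_stoppingCode hT hp, Finset.sum_eq_single_of_mem m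
      (Finset.self_mem_range_succ m) fun n _ hn => by
        rw [lengthProb_stoppingCode, h0 n hn, ENNReal.ofReal_zero, mul_zero]]
    refine (klDivBits_mul_lengthProb_le_length _ _
      (fun v => jointProb_nonneg hp X v) (stopProb_stoppingCode hp X)).trans ?_
    have hsum : ∑ v : Fin m → Bool, jointProb p T X v = 1 := (sum_stopProb p X m).trans h1
    simp only [hsum]
    have hlog := Real.log_two_gt_d9
    refine ENNReal.ofReal_le_ofReal ?_
    rw [div_le_iff₀ (by linarith)]
    nlinarith

end Codes

/-! ### Asymptotics -/

lemma tendsto_log_add_two_div :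
    Tendsto (fun m : ℕ => Real.log ((m : ℝ) + 2) / m) atTop (𝓝 0) := by
  have h1 : Tendsto (fun x : ℝ => Real.log x / x) atTop (𝓝 0) :=
    Real.isLittleO_log_id_atTop.tendsto_div_nhds_zero
  have h2 : Tendsto (fun m : ℕ => (m : ℝ) + 2) atTop atTop :=
    tendsto_atTop_add_const_right _ _ tendsto_natCast_atTop_atTop
  have h3 : Tendsto (fun m : ℕ => 1 + 2 / (m : ℝ)) atTop (𝓝 (1 + 0)) :=
    tendsto_const_nhds.add (tendsto_const_nhds.div_atTop tendsto_natCast_atTop_atTop)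
  have h4 := (h1.comp h2).mul h3
  rw [zero_mul] at h4
  refine h4.congr' ?_
  filter_upwards [eventually_gt_atTop 0] with m hm
  have : (m : ℝ) ≠ 0 := by positivity
  have : (m : ℝ) + 2 ≠ 0 := by positivity
  simp only [Function.comp]
  field_simp

lemma tendsto_sqrt_mul_log_div :
    Tendsto (fun m : ℕ => Real.sqrt m * Real.log m / m) atTop (𝓝 0) := by
  have h1 : Tendsto (fun x : ℝ => Real.log x / x ^ (1 / 2 : ℝ)) atTop (𝓝 0) :=
    (isLittleO_log_rpow_atTop (by norm_num)).tendsto_div_nhds_zero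
  refine (h1.comp tendsto_natCast_atTop_atTop).congr' ?_
  filter_upwards [eventually_gt_atTop 0] with m hm
  have hm' : (0 : ℝ) < m := by positivity
  have hs : Real.sqrt m ≠ 0 := (Real.sqrt_pos.2 hm').ne'
  simp only [Function.comp, ← Real.sqrt_eq_rpow]
  rw [div_eq_div_iff hs hm'.ne', mul_right_comm, Real.mul_self_sqrt hm'.le, mul_comm]

/-- Block lengths giving the rate `R`. -/
lemma exists_blockLength {R : ℝ} (hR : 0 ≤ R) :
    ∃ m : ℕ → ℕ, Tendsto m atTop atTop ∧ Tendsto (fun k : ℕ => (k : ℝ) / m k) atTop (𝓝 R) := by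
  rcases hR.eq_or_lt with rfl | hR
  -- At rate zero any superlinear block length works; here `k / m = 1 / k`.
  · refine ⟨fun k => k ^ 2, tendsto_pow_atTop two_ne_zero, ?_⟩
    refine (tendsto_inv_atTop_nhds_zero_nat (𝕜 := ℝ)).congr fun k => ?_
    rcases eq_or_ne k 0 with rfl | hk
    · simp
    · push_cast
      field_simp
  · have h1 : Tendsto (fun k : ℕ => (k : ℝ) / R) atTop atTop :=
      tendsto_natCast_atTop_atTop.atTop_div_const hR
    refine ⟨fun k => ⌈(k : ℝ) / R⌉₊, tendsto_nat_ceil_atTop.comp h1, ?_⟩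
    have h2 := (((tendsto_nat_ceil_div_atTop (R := ℝ)).comp h1).inv₀ one_ne_zero).const_mul R
    rw [inv_one, mul_one] at h2
    refine h2.congr fun k => ?_
    simp only [Function.comp, inv_div]
    field_simp

lemma elog2_ofReal {d : ℝ} (hd : 0 < d) :
    elog2 (ENNReal.ofReal d) = ((Real.log d / Real.log 2 : ℝ) : EReal) := by
  rw [elog2, ENNReal.log_ofReal_of_pos hd, EReal.coe_div]

lemma elog2_mono {x y : ℝ≥0∞} (h : x ≤ y) : elog2 x ≤ elog2 y :=
  EReal.div_le_div_right_of_nonneg (by exact_mod_cast Real.log_nonneg one_le_two)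
    (ENNReal.log_monotone h)

/-- Rate and exponent of codes with expected lengths `e` and divergences at most `d`. -/
lemma achieves_of_tendsto {W : Bool → PMF Bool} {PV : PMF Bool}
    {C : (k : ℕ) → FeedbackCode Bool Bool k} {R E : ℝ} {m : ℕ → ℕ} {e d : ℕ → ℝ}
    (hm : Tendsto m atTop atTop) (hmR : Tendsto (fun k : ℕ => (k : ℝ) / m k) atTop (𝓝 R))
    (hlen : ∀ k, expectedLength W (C k) = ENNReal.ofReal (e k))
    (hem : Tendsto (fun k => e k / m k) atTop (𝓝 1)) (hd : ∀ k, 0 < d k)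
    (hdiv : ∀ k, expectedDivergence W PV (C k) ≤ ENNReal.ofReal (d k))
    (hdE : Tendsto (fun k => -(Real.log (d k) / Real.log 2) / m k) atTop (𝓝 E)) :
    AchievesRateExponent W PV C R E ∧
      Tendsto (fun k : ℕ => (k : ℝ≥0∞) / expectedLength W (C k)) atTop
        (𝓝 (ENNReal.ofReal R)) := by
  have hm0 : ∀ᶠ k in atTop, (0 : ℝ) < m k := by
    filter_upwards [hm.eventually_gt_atTop 0] with k hk
    exact_mod_cast hk
  have he0 : ∀ᶠ k in atTop, 0 < e k := by
    filter_upwards [hm0, hem.eventually_const_lt zero_lt_one] with k hk hk'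
    exact (div_pos_iff_of_pos_right hk).1 hk'
  -- Since `e k ~ m k`, normalising by the block length or by the expected length gives the same
  -- limits.
  have hquot : ∀ {f : ℕ → ℝ} {l : ℝ}, Tendsto (fun k => f k / m k) atTop (𝓝 l) →
      Tendsto (fun k => f k / e k) atTop (𝓝 l) := by
    intro f l hf
    have := hf.div hem one_ne_zero
    rw [div_one] at this
    refine this.congr' ?_
    filter_upwards [hm0] with k hk
    exact div_div_div_cancel_right₀ hk.ne' _ _
  have hrate : Tendsto (fun k : ℕ => (k : ℝ≥0∞) / expectedLength W (C k)) atTop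
      (𝓝 (ENNReal.ofReal R)) := by
    refine (ENNReal.tendsto_ofReal (hquot hmR)).congr' ?_
    filter_upwards [he0] with k hk
    rw [hlen, ENNReal.ofReal_div_of_pos hk, ENNReal.ofReal_natCast]
  have hR : 0 ≤ R := ge_of_tendsto' hmR fun k => by positivity
  refine ⟨⟨fun k => by rw [hlen]; exact ENNReal.ofReal_ne_top, ?_, ?_⟩, hrate⟩
  · refine (((continuous_coe_ennreal_ereal.tendsto _).comp hrate).limsup_eq).trans_le ?_
    rw [EReal.coe_ennreal_ofReal, max_eq_left hR]
  · have hlim : Tendsto (fun k => ((-(Real.log (d k) / Real.log 2) / e k : ℝ) : EReal)) atTop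
        (𝓝 (E : EReal)) := (continuous_coe_real_ereal.tendsto E).comp (hquot hdE)
    rw [← hlim.liminf_eq]
    refine liminf_le_liminf ?_
    filter_upwards [he0] with k hk
    rw [hlen, EReal.coe_ennreal_ofReal, max_eq_left hk.le, EReal.coe_div, EReal.coe_neg,
      ← elog2_ofReal (hd k)]
    refine EReal.div_le_div_right_of_nonneg (by exact_mod_cast hk.le) ?_
    exact EReal.neg_le_neg_iff.2 (elog2_mono (hdiv k))

/-- The threshold for block length `m`: slightly above the mean information density. -/
def threshold (p : ℝ) (m : ℕ) : ℝ :=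
  m * (binCapacity p * Real.log 2) + 2 * (Real.sqrt m * Real.log m)

lemma threshold_nonneg (p : ℝ) (m : ℕ) : 0 ≤ threshold p m := by
  have := binCapacity_nonneg p
  have := Real.log_nonneg one_le_two
  have := Real.log_natCast_nonneg m
  unfold threshold
  positivity

/-- Apply the Chernoff bound with `s = 1 / √m`. The quadratic term becomes the constant `B ^ 2`, and
the excess `2 √m log m` of the threshold gives a factor `m ^ (-2)`. The total probability of
stopping early is thus `O(1 / m)`, which shortens the mean by `O(1)`. -/
lemma exists_le_expectedLength {p : ℝ} (hp : p ∈ Set.Icc (0 : ℝ) 1) :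
    ∃ K : ℝ, ∀ᶠ m : ℕ in atTop, m - K ≤ ∑ i ∈ Finset.range (m + 1),
      i * stopTimeProb p (thresholdRule p (threshold p m) m) i := by
  obtain ⟨B, hB⟩ : ∃ B : ℝ, ∀ b, |Real.log (2 * flipProb p b)| ≤ B :=
    ⟨∑ b, |Real.log (2 * flipProb p b)|, fun b =>
      Finset.single_le_sum (f := fun b => |Real.log (2 * flipProb p b)|)
        (fun _ _ => abs_nonneg _) (Finset.mem_univ b)⟩
  refine ⟨Real.exp (B ^ 2), ?_⟩
  filter_upwards [eventually_gt_atTop 0,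
    (Real.tendsto_sqrt_atTop.comp tendsto_natCast_atTop_atTop).eventually_ge_atTop B]
    with m hm hmB
  have hm' : (0 : ℝ) < m := by exact_mod_cast hm
  have hs : 0 < Real.sqrt m := Real.sqrt_pos.2 hm'
  refine le_trans ?_ (le_expectedLength_stoppingCode (fun z => Or.inl rfl) hp)
  have hearly : ∀ i ∈ Finset.range m, stopTimeProb p (thresholdRule p (threshold p m) m) i
      ≤ Real.exp (B ^ 2) / m ^ 2 := by
    intro i hi
    refine (stopTimeProb_thresholdRule_le hp (inv_nonneg.2 hs.le) hB ?_
      (Finset.mem_range.1 hi)).trans_eq ?_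
    · rw [inv_mul_le_iff₀ hs, mul_one]
      exact hmB
    · have h2 : (Real.sqrt m)⁻¹ * threshold p m
          = m * ((Real.sqrt m)⁻¹ * (binCapacity p * Real.log 2)) + Real.log (m ^ 2) := by
        rw [threshold, Real.log_pow]
        field_simp
        push_cast
        ring
      have h3 : (m : ℝ) * ((Real.sqrt m)⁻¹ ^ 2 * B ^ 2) = B ^ 2 := by
        rw [inv_pow, Real.sq_sqrt hm'.le]
        field_simp
      rw [h2, mul_add, h3, add_sub_add_left_eq_sub, Real.exp_sub, Real.exp_log (by positivity)]
  have hsum := Finset.sum_le_sum hearly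
  rw [Finset.sum_const, Finset.card_range, nsmul_eq_mul] at hsum
  calc (m : ℝ) - Real.exp (B ^ 2) = m * (1 - m * (Real.exp (B ^ 2) / m ^ 2)) := by field_simp
    _ ≤ _ := by gcongr

end Resolvability

end

open Resolvability in
theorem theorem2 (p : ℝ) (hp : p ∈ Set.Icc (0 : ℝ) 1) (R : ℝ) (hR : 0 ≤ R) :
    ∃ C : (k : ℕ) → Resolvability.FeedbackCode Bool Bool k,
      Resolvability.AchievesRateExponent (Resolvability.bsc p hp)
        (PMF.uniformOfFintype Bool) C R (max (R - Resolvability.binCapacity p) 0) ∧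
      Tendsto (fun k : ℕ =>
          (k : ℝ≥0∞) / Resolvability.expectedLength (Resolvability.bsc p hp) (C k))
        atTop (𝓝 (ENNReal.ofReal R)) := by
  obtain ⟨m, hm, hmR⟩ := exists_blockLength hR
  have hmR' : Tendsto (fun k => (m k : ℝ)) atTop atTop := tendsto_natCast_atTop_atTop.comp hm
  have hm0 : ∀ᶠ k in atTop, (m k : ℝ) ≠ 0 := hmR'.eventually_ne_atTop 0
  have hlog : Real.log 2 ≠ 0 := (Real.log_pos one_lt_two).ne'
  have hloglim := tendsto_log_add_two_div.comp hm
  rcases le_total R (binCapacity p) with hRc | hRc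
  · choose C hlen hdiv using fun k => exists_fixedLengthCode hp k (m k)
    refine ⟨C, achieves_of_tendsto hm hmR hlen ?_ (fun k => by positivity) hdiv ?_⟩
    · refine tendsto_const_nhds.congr' ?_
      filter_upwards [hm0] with k hk
      exact (div_self hk).symm
    · rw [max_eq_right (sub_nonpos.2 hRc)]
      have := (hloglim.div_const (Real.log 2)).neg
      rw [zero_div, neg_zero] at this
      refine this.congr fun k => ?_
      simp only [Function.comp]
      ring
  · choose C hlen hdiv using fun k => exists_thresholdCode hp k (m k) (threshold_nonneg p (m k))
    obtain ⟨K, hK⟩ := exists_le_expectedLength hp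
    -- Weakening `m + 1` to `m + 2` lets both cases use the same logarithmic limit.
    have hdiv' : ∀ k, expectedDivergence (bsc p hp) (PMF.uniformOfFintype Bool) (C k)
        ≤ ENNReal.ofReal
          ((m k + 2) * ((2 ^ k)⁻¹ * (2 * Real.exp (threshold p (m k)))) / Real.log 2) := by
      intro k
      have := Real.log_pos one_lt_two
      refine (hdiv k).trans (ENNReal.ofReal_le_ofReal ?_)
      gcongr
      norm_num
    have hpos := Real.log_pos one_lt_two
    refine ⟨C, achieves_of_tendsto hm hmR hlen ?_ (fun k => by positivity) hdiv' ?_⟩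
    · have hlow : Tendsto (fun k => 1 - K / (m k : ℝ)) atTop (𝓝 1) := by
        simpa using tendsto_const_nhds.sub (tendsto_const_nhds.div_atTop hmR')
      refine tendsto_of_tendsto_of_tendsto_of_le_of_le' hlow tendsto_const_nhds ?_ ?_
      · filter_upwards [hm0, hm.eventually hK] with k hk hk'
        have : (0 : ℝ) < m k := lt_of_le_of_ne (Nat.cast_nonneg _) hk.symm
        rw [le_div_iff₀ this, sub_mul, div_mul_cancel₀ _ hk, one_mul]
        exact hk'
      · exact Eventually.of_forall fun k => div_le_one_of_le₀
          (expectedLength_stoppingCode_le (fun z => Or.inl rfl) hp) (Nat.cast_nonneg _)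
    · rw [max_eq_left (sub_nonneg.2 hRc)]
      have hsq := tendsto_sqrt_mul_log_div.comp hm
      have hconst : Tendsto (fun k => (Real.log 2 - Real.log (Real.log 2)) / (m k : ℝ))
          atTop (𝓝 0) := tendsto_const_nhds.div_atTop hmR'
      -- The normalised exponent is `k / m - c₂(p)` minus three corrections: the polynomial
      -- prefactor, the constants, and the threshold excess, all `o(1)`.
      have hlim := ((hmR.sub_const (binCapacity p)).sub
        (((hloglim.add hconst).add (hsq.const_mul 2)).div_const (Real.log 2)))
      simp only [add_zero, mul_zero, zero_div, sub_zero] at hlim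
      refine hlim.congr' ?_
      filter_upwards [hm0] with k hk
      have h2 : (m k : ℝ) + 2 ≠ 0 := by positivity
      rw [Real.log_div (by positivity) hlog, Real.log_mul h2 (by positivity),
        Real.log_mul (by positivity) (by positivity), Real.log_inv, Real.log_pow,
        Real.log_mul two_ne_zero (Real.exp_ne_zero _), Real.log_exp, threshold]
      simp only [Function.comp]
      field_simp
      ring
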